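/- A \emph{distributive $\ell$-monoid} is an algebra $\langle M,\wedge,\vee,\cdot,e\rangle$ such that $\langle M,\wedge,\vee\rangle$ is a distributive lattice, $\langle M,\cdot,e\rangle$ is a monoid, and $a(b\vee c)d=abd\vee acd$ and $a(b\wedge c)d=abd\wedge acd$ for all $a,b,c,d\in M$. It is an \emph{ordered monoid} if its lattice order is total, and \emph{idempotent} if $xx=x$ for all $x\in M$. Let $\mathsf{SemDLM}$ be the variety generated by all ordered monoids, $\mathsf{IdDLM}$ the variety of idempotent distributive $\ell$-monoids, and $\mathsf{SemIdDLM}=\mathsf{SemDLM}\cap\mathsf{IdDLM}$. Let $\mathbf G_3$ and $\mathbf D_3$ be the idempotent ordered monoids on the three-element chain $\bot<e<\top$ with identity $e$ in which, respectively, $\bot\top=\bot,\ \top\bot=\top$ (for $\mathbf G_3$) and $\bot\top=\top,\ \top\bot=\bot$ (for $\mathbf D_3$). Let $\mathbf C_2$ and $\mathbf C_2^\partial$ be the idempotent ordered monoids with identity $e$ on the two-element chains $\bot<e$ and $e<\top$, respectively. Let $\mathcal S_1=\langle \mathbf C_2\hookrightarrow\mathbf G_3,\ \mathbf C_2\hookrightarrow\mathbf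 D_3\rangle$ and $\mathcal S_2=\langle \mathbf C_2^\partial\hookrightarrow\mathbf G_3,\ \mathbf C_2^\partial\hookrightarrow\mathbf D_3\rangle$ be the spans of inclusion maps. An \emph{amalgam} in a class $\mathsf K$ of a span of embeddings $\langle i_1\colon\mathbf A\hookrightarrow\mathbf B,\ i_2\colon\mathbf A\hookrightarrow\mathbf C\rangle$ is an algebra $\mathbf D\in\mathsf K$ together with embeddings $j_1\colon\mathbf B\hookrightarrow\mathbf D$, $j_2\colon\mathbf C\hookrightarrow\mathbf D$ such that $j_1\circ i_1=j_2\circ i_2$. The class $\mathsf K$ has the \emph{amalgamation property} if every span of embeddings between members of $\mathsf K$ has an amalgam in $\mathsf K$. Then: \begin{enumerate} \item Neither $\mathcal S_1$ nor $\mathcal S_2$ has an amalgam in $\mathsf{SemDLM}$, and neither has an amalgam in $\mathsf{IdDLM}$. \item No subvariety of $\mathsf{SemDLM}$ and no subvariety of $\mathsf{IdDLM}$ that contains both $\mathbf G_3$ and $\mathbf D_3$ has the amalgamation property. \item In particular, none of the varieties $\mathsf{SemDLM}$, $\mathsf{SemIdDLM}$ and $\mathsf{IdDLM}$ has the amalgamation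 property. \end{enumerate} -/

import Mathlib

universe u

/-- A distributive `ℓ`-monoid: a distributive lattice together with a monoid structure
(whose identity `e` is written `1`) such that multiplication on both sides distributes over
binary joins and binary meets. -/
class DistribLMonoid (M : Type u) extends DistribLattice M, Monoid M where
  mul_sup_mul : ∀ a b c d : M, a * (b ⊔ c) * d = a * b * d ⊔ a * c * d
  mul_inf_mul : ∀ a b c d : M, a * (b ⊓ c) * d = a * b * d ⊓ a * c * d

namespace DistribLMonoid

/-- Homomorphisms of distributive `ℓ`-monoids: maps preserving `⊓`, `⊔`, `*` and `1`. -/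
structure Hom (M N : Type u) [DistribLMonoid M] [DistribLMonoid N] where
  toFun : M → N
  map_one : toFun 1 = 1
  map_mul : ∀ a b, toFun (a * b) = toFun a * toFun b
  map_sup : ∀ a b, toFun (a ⊔ b) = toFun a ⊔ toFun b
  map_inf : ∀ a b, toFun (a ⊓ b) = toFun a ⊓ toFun b

/-- Direct products, with componentwise operations. -/
instance instPi {I : Type u} (A : I → Type u) [∀ i, DistribLMonoid (A i)] :
    DistribLMonoid (∀ i, A i) where
  mul_sup_mul a b c d := funext fun i => mul_sup_mul (a i) (b i) (c i) (d i)
  mul_inf_mul a b c d := funext fun i => mul_inf_mul (a i) (b i) (c i) (d i)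

/-! ### Classes of algebras, varieties -/

/-- A class of distributive `ℓ`-monoids. -/
abbrev AlgClass : Type (u + 1) := ∀ (M : Type u) [DistribLMonoid M], Prop

/-- Inclusion of classes. -/
def AlgClass.Subclass (K L : AlgClass.{u}) : Prop :=
  ∀ (M : Type u) [DistribLMonoid M], K M → L M

/-- A variety of distributive `ℓ`-monoids: a class closed under homomorphic images,
subalgebras (equivalently, together with the previous closure, under algebras that embed into
a member) and direct products. The empty product makes such a class non-empty. -/
structure IsVariety (K : AlgClass.{u}) : Prop where
  homImage : ∀ (M N : Type u) [DistribLMonoid M] [DistribLMonoid N] (f : Hom M N),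
    Function.Surjective f.toFun → K M → K N
  subalgebra : ∀ (M N : Type u) [DistribLMonoid M] [DistribLMonoid N] (f : Hom M N),
    Function.Injective f.toFun → K N → K M
  product : ∀ (I : Type u) (A : I → Type u) [∀ i, DistribLMonoid (A i)],
    (∀ i, K (A i)) → K (∀ i, A i)

/-- The variety generated by a class `K`: the smallest variety containing `K`. -/
def varietyGenerated (K : AlgClass.{u}) : AlgClass.{u} :=
  fun M _ => ∀ V : AlgClass.{u}, IsVariety V → K.Subclass V → V M

/-- The class of ordered monoids: distributive `ℓ`-monoids whose lattice order is total. -/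
def OM : AlgClass.{u} := fun M _ => ∀ a b : M, a ≤ b ∨ b ≤ a

/-- Semilinear distributive `ℓ`-monoids: the variety generated by the ordered monoids. -/
def SemDLM : AlgClass.{u} := varietyGenerated OM

/-- Idempotent distributive `ℓ`-monoids. -/
def IdDLM : AlgClass.{u} := fun M _ => ∀ a : M, a * a = a

/-- Semilinear idempotent distributive `ℓ`-monoids. -/
def SemIdDLM : AlgClass.{u} := fun M _ => SemDLM M ∧ IdDLM M

/-! ### Spans and amalgamation -/

/-- A span of embeddings `i₁ : A ↪ B`, `i₂ : A ↪ C`. -/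
structure Span where
  A : Type u
  B : Type u
  C : Type u
  [instA : DistribLMonoid A]
  [instB : DistribLMonoid B]
  [instC : DistribLMonoid C]
  i₁ : Hom A B
  i₂ : Hom A C
  i₁_injective : Function.Injective i₁.toFun
  i₂_injective : Function.Injective i₂.toFun

attribute [instance] Span.instA Span.instB Span.instC

/-- `S` is a span in the class `K`. -/
def Span.IsIn (S : Span.{u}) (K : AlgClass.{u}) : Prop := K S.A ∧ K S.B ∧ K S.C

/-- `S` has an amalgam in the class `K`. -/
def Span.HasAmalgamIn (S : Span.{u}) (K : AlgClass.{u}) : Prop :=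
  ∃ (D : Type u) (_ : DistribLMonoid D) (j₁ : Hom S.B D) (j₂ : Hom S.C D),
    K D ∧ Function.Injective j₁.toFun ∧ Function.Injective j₂.toFun ∧
      ∀ a : S.A, j₁.toFun (S.i₁.toFun a) = j₂.toFun (S.i₂.toFun a)

/-- The amalgamation property of a class `K`. -/
def AmalgamationProperty (K : AlgClass.{u}) : Prop :=
  ∀ S : Span.{u}, S.IsIn K → S.HasAmalgamIn K

/-! ### The algebras `C₂`, `C₂ᵈ`, `G₃`, `D₃` -/

/-- Universe of `C₂`: the chain `bot < e`. -/
inductive C₂ : Type u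
  | bot | e

/-- Universe of the order dual `C₂ᵈ` of `C₂`: the chain `e < top`. -/
inductive C₂d : Type u
  | e | top

/-- Universe of `G₃`: the chain `bot < e < top`. -/
inductive G₃ : Type u
  | bot | e | top

/-- Universe of `D₃`: the chain `bot < e < top`. -/
inductive D₃ : Type u
  | bot | e | top

/-- Position in the chain. -/
def C₂.rank : C₂.{u} → ℕ
  | .bot => 0
  | .e => 1

/-- Position in the chain. -/
def C₂d.rank : C₂d.{u} → ℕ
  | .e => 0
  | .top => 1

/-- Position in the chain. -/
def G₃.rank : G₃.{u} → ℕ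
  | .bot => 0
  | .e => 1
  | .top => 2

/-- Position in the chain. -/
def D₃.rank : D₃.{u} → ℕ
  | .bot => 0
  | .e => 1
  | .top => 2

instance : LinearOrder C₂.{u} :=
  LinearOrder.lift' C₂.rank (by rintro (_ | _) (_ | _) h <;> first | rfl | cases h)

instance : LinearOrder C₂d.{u} :=
  LinearOrder.lift' C₂d.rank (by rintro (_ | _) (_ | _) h <;> first | rfl | cases h)

instance : LinearOrder G₃.{u} :=
  LinearOrder.lift' G₃.rank (by rintro (_ | _ | _) (_ | _ | _) h <;> first | rfl | cases h)

instance : LinearOrder D₃.{u} :=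
  LinearOrder.lift' D₃.rank (by rintro (_ | _ | _) (_ | _ | _) h <;> first | rfl | cases h)

/-- Multiplication of `C₂`: `bot` is absorbing. -/
def C₂.mul : C₂.{u} → C₂.{u} → C₂.{u}
  | .e, y => y
  | .bot, _ => .bot

/-- Multiplication of `C₂ᵈ`: `top` is absorbing. -/
def C₂d.mul : C₂d.{u} → C₂d.{u} → C₂d.{u}
  | .e, y => y
  | .top, _ => .top

/-- Multiplication of `G₃`: the non-identity elements are left-absorbing, so
`bot * top = bot` and `top * bot = top`. -/
def G₃.mul : G₃.{u} → G₃.{u} → G₃.{u}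
  | .e, y => y
  | .bot, _ => .bot
  | .top, _ => .top

/-- Multiplication of `D₃`: the non-identity elements are right-absorbing, so
`bot * top = top` and `top * bot = bot`. -/
def D₃.mul : D₃.{u} → D₃.{u} → D₃.{u}
  | x, .e => x
  | _, .bot => .bot
  | _, .top => .top

instance : DistribLMonoid C₂.{u} where
  one := .e
  mul := C₂.mul
  mul_assoc := by rintro (_ | _) (_ | _) (_ | _) <;> rfl
  one_mul := by rintro (_ | _) <;> rfl
  mul_one := by rintro (_ | _) <;> rfl
  mul_sup_mul := by rintro (_ | _) (_ | _) (_ | _) (_ | _) <;> rfl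
  mul_inf_mul := by rintro (_ | _) (_ | _) (_ | _) (_ | _) <;> rfl

instance : DistribLMonoid C₂d.{u} where
  one := .e
  mul := C₂d.mul
  mul_assoc := by rintro (_ | _) (_ | _) (_ | _) <;> rfl
  one_mul := by rintro (_ | _) <;> rfl
  mul_one := by rintro (_ | _) <;> rfl
  mul_sup_mul := by rintro (_ | _) (_ | _) (_ | _) (_ | _) <;> rfl
  mul_inf_mul := by rintro (_ | _) (_ | _) (_ | _) (_ | _) <;> rfl

instance : DistribLMonoid G₃.{u} where
  one := .e
  mul := G₃.mul
  mul_assoc := by rintro (_ | _ | _) (_ | _ | _) (_ | _ | _) <;> rfl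
  one_mul := by rintro (_ | _ | _) <;> rfl
  mul_one := by rintro (_ | _ | _) <;> rfl
  mul_sup_mul := by rintro (_ | _ | _) (_ | _ | _) (_ | _ | _) (_ | _ | _) <;> rfl
  mul_inf_mul := by rintro (_ | _ | _) (_ | _ | _) (_ | _ | _) (_ | _ | _) <;> rfl

instance : DistribLMonoid D₃.{u} where
  one := .e
  mul := D₃.mul
  mul_assoc := by rintro (_ | _ | _) (_ | _ | _) (_ | _ | _) <;> rfl
  one_mul := by rintro (_ | _ | _) <;> rfl
  mul_one := by rintro (_ | _ | _) <;> rfl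
  mul_sup_mul := by rintro (_ | _ | _) (_ | _ | _) (_ | _ | _) (_ | _ | _) <;> rfl
  mul_inf_mul := by rintro (_ | _ | _) (_ | _ | _) (_ | _ | _) (_ | _ | _) <;> rfl

/-! ### The two forbidden spans -/

/-- The inclusion `C₂ ↪ G₃`. -/
def C₂.toG₃ : Hom C₂.{u} G₃.{u} where
  toFun | .bot => .bot
        | .e => .e
  map_one := rfl
  map_mul := by rintro (_ | _) (_ | _) <;> rfl
  map_sup := by rintro (_ | _) (_ | _) <;> rfl
  map_inf := by rintro (_ | _) (_ | _) <;> rfl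

/-- The inclusion `C₂ ↪ D₃`. -/
def C₂.toD₃ : Hom C₂.{u} D₃.{u} where
  toFun | .bot => .bot
        | .e => .e
  map_one := rfl
  map_mul := by rintro (_ | _) (_ | _) <;> rfl
  map_sup := by rintro (_ | _) (_ | _) <;> rfl
  map_inf := by rintro (_ | _) (_ | _) <;> rfl

/-- The inclusion `C₂ᵈ ↪ G₃`. -/
def C₂d.toG₃ : Hom C₂d.{u} G₃.{u} where
  toFun | .e => .e
        | .top => .top
  map_one := rfl
  map_mul := by rintro (_ | _) (_ | _) <;> rfl
  map_sup := by rintro (_ | _) (_ | _) <;> rfl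
  map_inf := by rintro (_ | _) (_ | _) <;> rfl

/-- The inclusion `C₂ᵈ ↪ D₃`. -/
def C₂d.toD₃ : Hom C₂d.{u} D₃.{u} where
  toFun | .e => .e
        | .top => .top
  map_one := rfl
  map_mul := by rintro (_ | _) (_ | _) <;> rfl
  map_sup := by rintro (_ | _) (_ | _) <;> rfl
  map_inf := by rintro (_ | _) (_ | _) <;> rfl

/-- The span `S₁`, given by the inclusions `C₂ ↪ G₃` and `C₂ ↪ D₃`. -/
def spanS₁ : Span.{u} where
  A := C₂
  B := G₃
  C := D₃
  i₁ := C₂.toG₃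
  i₂ := C₂.toD₃
  i₁_injective := by rintro (_ | _) (_ | _) h <;> first | rfl | cases h
  i₂_injective := by rintro (_ | _) (_ | _) h <;> first | rfl | cases h

/-- The span `S₂`, given by the inclusions `C₂ᵈ ↪ G₃` and `C₂ᵈ ↪ D₃`. -/
def spanS₂ : Span.{u} where
  A := C₂d
  B := G₃
  C := D₃
  i₁ := C₂d.toG₃
  i₂ := C₂d.toD₃
  i₁_injective := by rintro (_ | _) (_ | _) h <;> first | rfl | cases h
  i₂_injective := by rintro (_ | _) (_ | _) h <;> first | rfl | cases h

end DistribLMonoid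

universe v

namespace DistribLMonoid

/-! ### Monotonicity of multiplication and products on one side of the identity -/

section Basic

variable {M : Type v} [DistribLMonoid M]

/-! In an amalgam of `spanS₁` the shared bottom `b` meets two tops: `t` from `G₃`, with `b * t = b`
and `t * b = t`, and `s` from `D₃`, with `b * s = s` and `s * b = b`. Each setting rules this out by
its own argument. In `SemDLM` the obstruction is an inequality valid in all chains, hence in the
variety they generate: `z * s ⊓ t * w ≤ z * t ⊔ s * w`. At `z = w = b` it gives `s ⊓ t ≤ b`,
although `1 ≤ s ⊓ t` and `b` lies strictly below `1`. In `IdDLM` elements above `1` multiply to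
their join, so `s * t = s ⊔ t`. Multiplying by `b` on the left fixes the product but sends the join
to `s`; on the right it sends the join to `t`. So `s = t`, whence `s = b * s = b * t = b`, a
contradiction. The span `spanS₂` is treated by the order-dual argument. For subvarieties, `spanS₁`
suffices, since `C₂` embeds in `G₃`. -/

theorem mul_sup' (a b c : M) : a * (b ⊔ c) = a * b ⊔ a * c := by
  simpa using mul_sup_mul a b c 1

theorem sup_mul' (a b c : M) : (a ⊔ b) * c = a * c ⊔ b * c := by
  simpa using mul_sup_mul 1 a b c

theorem mul_inf' (a b c : M) : a * (b ⊓ c) = a * b ⊓ a * c := by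
  simpa using mul_inf_mul a b c 1

theorem inf_mul' (a b c : M) : (a ⊓ b) * c = a * c ⊓ b * c := by
  simpa using mul_inf_mul 1 a b c

theorem mul_le_mul_left_of_le {a b : M} (h : a ≤ b) (c : M) : c * a ≤ c * b := by
  rw [← sup_eq_right, ← mul_sup', sup_eq_right.2 h]

theorem mul_le_mul_right_of_le {a b : M} (h : a ≤ b) (c : M) : a * c ≤ b * c := by
  rw [← sup_eq_right, ← sup_mul', sup_eq_right.2 h]

/-- In an idempotent distributive `ℓ`-monoid, elements above `1` multiply to their join. -/
theorem mul_eq_sup_of_one_le (hM : IdDLM M) {s t : M} (hs : 1 ≤ s) (ht : 1 ≤ t) :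
    s * t = s ⊔ t := by
  apply le_antisymm
  · calc s * t ≤ (s ⊔ t) * t := mul_le_mul_right_of_le le_sup_left t
      _ ≤ (s ⊔ t) * (s ⊔ t) := mul_le_mul_left_of_le le_sup_right _
      _ = s ⊔ t := hM _
  · exact sup_le (by simpa using mul_le_mul_left_of_le ht s)
      (by simpa using mul_le_mul_right_of_le hs t)

/-- In an idempotent distributive `ℓ`-monoid, elements below `1` multiply to their meet. -/
theorem mul_eq_inf_of_le_one (hM : IdDLM M) {s t : M} (hs : s ≤ 1) (ht : t ≤ 1) :
    s * t = s ⊓ t := by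
  apply le_antisymm
  · exact le_inf (by simpa using mul_le_mul_left_of_le ht s)
      (by simpa using mul_le_mul_right_of_le hs t)
  · calc s ⊓ t = (s ⊓ t) * (s ⊓ t) := (hM _).symm
      _ ≤ s * (s ⊓ t) := mul_le_mul_right_of_le inf_le_left _
      _ ≤ s * t := mul_le_mul_left_of_le inf_le_right s

end Basic

/-! ### The exchange inequality and semilinearity -/

theorem Hom.monotone {M N : Type v} [DistribLMonoid M] [DistribLMonoid N] (f : Hom M N) :
    Monotone f.toFun := by
  intro a b h
  rw [← sup_eq_right, ← f.map_sup, sup_eq_right.2 h]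

theorem Hom.le_of_map_le {M N : Type v} [DistribLMonoid M] [DistribLMonoid N] (f : Hom M N)
    (hf : Function.Injective f.toFun) {a b : M} (h : f.toFun a ≤ f.toFun b) : a ≤ b :=
  sup_eq_right.1 (hf (by rw [f.map_sup, sup_eq_right.2 h]))

/-- The class axiomatized by the inequality `z * s ⊓ t * w ≤ z * t ⊔ s * w`. -/
def ExchangeIneq : AlgClass.{v} := fun M _ =>
  ∀ z s t w : M, z * s ⊓ t * w ≤ z * t ⊔ s * w

theorem isVariety_exchangeIneq : IsVariety ExchangeIneq.{v} where
  homImage M N _ _ f hf h z s t w := by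
    obtain ⟨z, rfl⟩ := hf z
    obtain ⟨s, rfl⟩ := hf s
    obtain ⟨t, rfl⟩ := hf t
    obtain ⟨w, rfl⟩ := hf w
    simpa only [f.map_inf, f.map_sup, f.map_mul] using f.monotone (h z s t w)
  subalgebra M N _ _ f hf h z s t w := by
    apply f.le_of_map_le hf
    simpa only [f.map_inf, f.map_sup, f.map_mul] using h _ _ _ _
  product I A _ h z s t w := fun i => h i (z i) (s i) (t i) (w i)

/-- Totality compares `s` with `t`, and in either case one meetand on the left lies below one
joinand on the right. -/
theorem exchangeIneq_of_OM : OM.{v}.Subclass ExchangeIneq := by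
  intro M _ h z s t w
  rcases h s t with hst | hts
  · exact inf_le_left.trans ((mul_le_mul_left_of_le hst z).trans le_sup_left)
  · exact inf_le_right.trans ((mul_le_mul_right_of_le hts w).trans le_sup_right)

theorem exchangeIneq_of_SemDLM : SemDLM.{v}.Subclass ExchangeIneq :=
  fun _ _ h => h _ isVariety_exchangeIneq exchangeIneq_of_OM

/-! ### Closure properties of the classes involved -/

theorem isVariety_varietyGenerated (K : AlgClass.{v}) : IsVariety (varietyGenerated K) where
  homImage M N _ _ f hf h V hV hK := hV.homImage M N f hf (h V hV hK)
  subalgebra M N _ _ f hf h V hV hK := hV.subalgebra M N f hf (h V hV hK)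
  product I A _ h V hV hK := hV.product I A fun i => h i V hV hK

theorem subclass_varietyGenerated (K : AlgClass.{v}) : K.Subclass (varietyGenerated K) :=
  fun M _ h _ _ hK => hK M h

theorem isVariety_IdDLM : IsVariety IdDLM.{v} where
  homImage M N _ _ f hf h a := by
    obtain ⟨a, rfl⟩ := hf a
    rw [← f.map_mul, h a]
  subalgebra M N _ _ f hf h a := hf (by rw [f.map_mul, h])
  product I A _ h a := funext fun i => h i (a i)

theorem isVariety_inter {K L : AlgClass.{v}} (hK : IsVariety K) (hL : IsVariety L) :
    IsVariety (fun M _ => K M ∧ L M) where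
  homImage M N _ _ f hf h := ⟨hK.homImage M N f hf h.1, hL.homImage M N f hf h.2⟩
  subalgebra M N _ _ f hf h := ⟨hK.subalgebra M N f hf h.1, hL.subalgebra M N f hf h.2⟩
  product I A _ h := ⟨hK.product I A fun i => (h i).1, hL.product I A fun i => (h i).2⟩

theorem Span.HasAmalgamIn.mono {S : Span.{v}} {K L : AlgClass.{v}} (h : S.HasAmalgamIn K)
    (hKL : K.Subclass L) : S.HasAmalgamIn L := by
  obtain ⟨D, _, j₁, j₂, hD, h⟩ := h
  exact ⟨D, _, j₁, j₂, hKL D hD, h⟩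

/-! ### Elements forced to exist in an amalgam -/

theorem bot_le_one_G₃ : (G₃.bot.{v}) ≤ 1 := Nat.zero_le 1
theorem one_le_top_G₃ : (1 : G₃.{v}) ≤ .top := Nat.le_succ 1
theorem bot_le_one_D₃ : (D₃.bot.{v}) ≤ 1 := Nat.zero_le 1
theorem one_le_top_D₃ : (1 : D₃.{v}) ≤ .top := Nat.le_succ 1

/-- An amalgam of `spanS₁` contains elements `b < 1 ≤ s, t` with `b * t = b`, `t * b = t`,
`b * s = s` and `s * b = b`. -/
theorem exists_of_hasAmalgamIn_spanS₁ {K : AlgClass.{v}} (h : spanS₁.HasAmalgamIn K) :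
    ∃ (D : Type v) (_ : DistribLMonoid D) (b s t : D), K D ∧ ¬ 1 ≤ b ∧ b ≤ 1 ∧ 1 ≤ s ∧ 1 ≤ t ∧
      b * t = b ∧ t * b = t ∧ b * s = s ∧ s * b = b := by
  obtain ⟨D, _, (j₁ : Hom G₃ D), (j₂ : Hom D₃ D), hD, hj₁, -, hj⟩ := h
  have hb : j₁.toFun .bot = j₂.toFun .bot := hj C₂.bot
  -- Here `b` is the common image of both bottoms, `s` the top of `D₃` and `t` the top of `G₃`.
  refine ⟨D, _, j₁.toFun .bot, j₂.toFun .top, j₁.toFun .top, hD, fun h => ?_,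
    ?_, ?_, ?_, ?_, ?_, ?_, ?_⟩
  · rw [← j₁.map_one] at h
    cases hj₁ ((j₁.monotone bot_le_one_G₃).antisymm h)
  · exact j₁.map_one ▸ j₁.monotone bot_le_one_G₃
  · exact j₂.map_one ▸ j₂.monotone one_le_top_D₃
  · exact j₁.map_one ▸ j₁.monotone one_le_top_G₃
  · exact (j₁.map_mul .bot .top).symm
  · exact (j₁.map_mul .top .bot).symm
  · rw [hb]; exact (j₂.map_mul .bot .top).symm
  · rw [hb]; exact (j₂.map_mul .top .bot).symm

/-- An amalgam of `spanS₂` contains elements `b, c ≤ 1 < t` with `b * t = b`, `t * b = t`,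
`c * t = t` and `t * c = c`. -/
theorem exists_of_hasAmalgamIn_spanS₂ {K : AlgClass.{v}} (h : spanS₂.HasAmalgamIn K) :
    ∃ (D : Type v) (_ : DistribLMonoid D) (b c t : D), K D ∧ ¬ t ≤ 1 ∧ 1 ≤ t ∧ b ≤ 1 ∧ c ≤ 1 ∧
      b * t = b ∧ t * b = t ∧ c * t = t ∧ t * c = c := by
  obtain ⟨D, _, (j₁ : Hom G₃ D), (j₂ : Hom D₃ D), hD, hj₁, -, hj⟩ := h
  have ht : j₁.toFun .top = j₂.toFun .top := hj C₂d.top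
  -- Dually, `t` is the common image of both tops, `b` the bottom of `G₃` and `c` the bottom of
  -- `D₃`.
  refine ⟨D, _, j₁.toFun .bot, j₂.toFun .bot, j₁.toFun .top, hD, fun h => ?_,
    ?_, ?_, ?_, ?_, ?_, ?_, ?_⟩
  · rw [← j₁.map_one] at h
    cases hj₁ ((j₁.monotone one_le_top_G₃).antisymm h)
  · exact j₁.map_one ▸ j₁.monotone one_le_top_G₃
  · exact j₁.map_one ▸ j₁.monotone bot_le_one_G₃
  · exact j₂.map_one ▸ j₂.monotone bot_le_one_D₃
  · exact (j₁.map_mul .bot .top).symm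
  · exact (j₁.map_mul .top .bot).symm
  · rw [ht]; exact (j₂.map_mul .bot .top).symm
  · rw [ht]; exact (j₂.map_mul .top .bot).symm

/-! ### Failure of amalgamation -/

theorem spanS₁_not_hasAmalgamIn_SemDLM : ¬ spanS₁.{v}.HasAmalgamIn SemDLM := by
  intro h
  obtain ⟨D, _, b, s, t, hD, hb, -, hs, ht, hbt, htb, hbs, hsb⟩ :=
    exists_of_hasAmalgamIn_spanS₁ (h.mono exchangeIneq_of_SemDLM)
  -- After rewriting, this reads `s ⊓ t ≤ b`.
  have key := hD b s t b
  rw [hbs, htb, hbt, hsb, sup_idem] at key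
  exact hb ((le_inf hs ht).trans key)

theorem spanS₂_not_hasAmalgamIn_SemDLM : ¬ spanS₂.{v}.HasAmalgamIn SemDLM := by
  intro h
  obtain ⟨D, _, b, c, t, hD, ht, -, hb, hc, hbt, htb, hct, htc⟩ :=
    exists_of_hasAmalgamIn_spanS₂ (h.mono exchangeIneq_of_SemDLM)
  -- After rewriting, this reads `t ≤ c ⊔ b`, and both joinands are at most `1`.
  have key := hD t b c t
  rw [htb, hct, htc, hbt, inf_idem] at key
  exact ht (key.trans (sup_le hc hb))

theorem spanS₁_not_hasAmalgamIn_IdDLM : ¬ spanS₁.{v}.HasAmalgamIn IdDLM := by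
  intro h
  obtain ⟨D, _, b, s, t, hD, hb, hb1, hs, ht, hbt, htb, hbs, hsb⟩ :=
    exists_of_hasAmalgamIn_spanS₁ h
  have hst := mul_eq_sup_of_one_le hD hs ht
  -- Left multiplication by `b` is computed twice: through `b * s = s` on the product, and termwise
  -- on the join.
  have h₁ : s * t = s := by
    calc s * t = b * (s * t) := by rw [← mul_assoc, hbs]
      _ = s := by rw [hst, mul_sup', hbs, hbt, sup_eq_left.2 (hb1.trans hs)]
  have h₂ : s * t = t := by
    calc s * t = s * t * b := by rw [mul_assoc, htb]
      _ = t := by rw [hst, sup_mul', hsb, htb, sup_eq_right.2 (hb1.trans ht)]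
  have hsb' : s = b := by rw [← hbs, h₁.symm.trans h₂, hbt]
  exact hb (hsb' ▸ hs)

theorem spanS₂_not_hasAmalgamIn_IdDLM : ¬ spanS₂.{v}.HasAmalgamIn IdDLM := by
  intro h
  obtain ⟨D, _, b, c, t, hD, ht, ht1, hb, hc, hbt, htb, hct, htc⟩ :=
    exists_of_hasAmalgamIn_spanS₂ h
  have hcb := mul_eq_inf_of_le_one hD hc hb
  -- The dual computation: `t` absorbs into `c * b` on either side, but sends the meet to `c` from
  -- the left and to `b` from the right.
  have h₁ : c * b = c := by
    calc c * b = t * (c * b) := by rw [← mul_assoc, htc]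
      _ = c := by rw [hcb, mul_inf', htc, htb, inf_eq_left.2 (hc.trans ht1)]
  have h₂ : c * b = b := by
    calc c * b = c * b * t := by rw [mul_assoc, hbt]
      _ = b := by rw [hcb, inf_mul', hct, hbt, inf_eq_right.2 (hb.trans ht1)]
  have htc' : t = c := by rw [← htb, ← h₁.symm.trans h₂, htc]
  exact ht (htc' ▸ hc)

/-- A variety containing `G₃` and `D₃` with the amalgamation property amalgamates `spanS₁`. -/
theorem AmalgamationProperty.hasAmalgamIn_spanS₁ {V : AlgClass.{v}} (h : AmalgamationProperty V)
    (hV : IsVariety V) (hG : V G₃) (hD : V D₃) : spanS₁.HasAmalgamIn V :=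
  h spanS₁ ⟨hV.subalgebra C₂ G₃ C₂.toG₃ spanS₁.i₁_injective hG, hG, hD⟩

theorem not_amalgamationProperty_of_isVariety {V : AlgClass.{v}} (hV : IsVariety V)
    (hsub : V.Subclass SemDLM ∨ V.Subclass IdDLM) (hG : V G₃) (hD : V D₃) :
    ¬ AmalgamationProperty V := by
  intro h
  have hS := h.hasAmalgamIn_spanS₁ hV hG hD
  rcases hsub with hsub | hsub
  · exact spanS₁_not_hasAmalgamIn_SemDLM (hS.mono hsub)
  · exact spanS₁_not_hasAmalgamIn_IdDLM (hS.mono hsub)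

theorem SemDLM_G₃ : SemDLM G₃.{v} :=
  subclass_varietyGenerated OM G₃ fun a b => Nat.le_total a.rank b.rank

theorem SemDLM_D₃ : SemDLM D₃.{v} :=
  subclass_varietyGenerated OM D₃ fun a b => Nat.le_total a.rank b.rank

theorem IdDLM_G₃ : IdDLM G₃.{v} := by rintro (_ | _ | _) <;> rfl

theorem IdDLM_D₃ : IdDLM D₃.{v} := by rintro (_ | _ | _) <;> rfl

end DistribLMonoid

theorem mainTheorem11 :
    -- the two spans have no amalgam in `SemDLM`, nor in `IdDLM`
    (¬ DistribLMonoid.spanS₁.{u}.HasAmalgamIn DistribLMonoid.SemDLM.{u} ∧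
      ¬ DistribLMonoid.spanS₂.{u}.HasAmalgamIn DistribLMonoid.SemDLM.{u} ∧
      ¬ DistribLMonoid.spanS₁.{u}.HasAmalgamIn DistribLMonoid.IdDLM.{u} ∧
      ¬ DistribLMonoid.spanS₂.{u}.HasAmalgamIn DistribLMonoid.IdDLM.{u}) ∧
    -- no subvariety of `SemDLM` or `IdDLM` containing `G₃` and `D₃` has amalgamation
    (∀ V : DistribLMonoid.AlgClass.{u}, DistribLMonoid.IsVariety V →
      (V.Subclass DistribLMonoid.SemDLM.{u} ∨ V.Subclass DistribLMonoid.IdDLM.{u}) →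
      V DistribLMonoid.G₃.{u} → V DistribLMonoid.D₃.{u} →
      ¬ DistribLMonoid.AmalgamationProperty V) ∧
    -- in particular, the three varieties fail amalgamation
    ¬ DistribLMonoid.AmalgamationProperty DistribLMonoid.SemDLM.{u} ∧
    ¬ DistribLMonoid.AmalgamationProperty DistribLMonoid.SemIdDLM.{u} ∧
    ¬ DistribLMonoid.AmalgamationProperty DistribLMonoid.IdDLM.{u} :=
  open DistribLMonoid in
  ⟨⟨spanS₁_not_hasAmalgamIn_SemDLM, spanS₂_not_hasAmalgamIn_SemDLM,
      spanS₁_not_hasAmalgamIn_IdDLM, spanS₂_not_hasAmalgamIn_IdDLM⟩,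
    fun _ hV hsub hG hD => not_amalgamationProperty_of_isVariety hV hsub hG hD,
    not_amalgamationProperty_of_isVariety (isVariety_varietyGenerated OM)
      (.inl fun _ _ h => h) SemDLM_G₃ SemDLM_D₃,
    not_amalgamationProperty_of_isVariety
      (isVariety_inter (isVariety_varietyGenerated OM) isVariety_IdDLM)
      (.inl fun _ _ h => h.1) ⟨SemDLM_G₃, IdDLM_G₃⟩ ⟨SemDLM_D₃, IdDLM_D₃⟩,
    not_amalgamationProperty_of_isVariety isVariety_IdDLM
      (.inr fun _ _ h => h) IdDLM_G₃ IdDLM_D₃⟩
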